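/- All algebras are associative, not necessarily unital algebras over $\mathbb{C}$, $\otimes$ is the algebraic tensor product, and for an algebra $B$ with non-degenerate product $M(B)$ denotes its multiplier algebra, which contains $B$. A multiplier Hopf $*$-algebra is a pair $(A,\delta)$ consisting of a $*$-algebra $A$ with non-degenerate product and a $*$-homomorphism $\delta\colon A\to M(A\otimes A)$ such that $T_1(a\otimes b)=\delta(a)(1\otimes b)$ and $T_2(a\otimes b)=(a\otimes 1)\delta(b)$ define bijective linear maps $T_1,T_2$ of $A\otimes A$ onto itself and $T_2\otimes\mathrm{id}$ commutes with $\mathrm{id}\otimes T_1$ on $A\otimes A\otimes A$. The homomorphism $\delta$ extends uniquely to a homomorphism of unital algebras $M(A)\to M(A\otimes A)$, again denoted by $\delta$. A discrete quantum group is a multiplier Hopf $*$-algebra $(A,\delta)$ such that the algebra $A$ is a direct sum of full matrix algebras $M_n(\mathbb{C})$, and its algebra of almost periodic elements is $$\mathscr{AP}=\{x\in M(A):\ \delta(x)\in M(A)\otimes M(A)\},$$ where $M(A)\otimes M(A)$ is regarded as a subalgebra of $M(A\otimes A)$. **Proposition.** Let $(A,\delta)$ be a discrete quantum group with $A$ infinite-dimensional.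 Then $\mathscr{AP}$ does not contain $A$. -/

import Mathlib

open scoped TensorProduct

/-! ### Algebras with non-degenerate product and their multipliers

Throughout, an algebra is an associative, not necessarily unital algebra over `ℂ`. -/

/-- The product of `A` is non-degenerate. -/
def NondegenerateProduct (A : Type*) [NonUnitalRing A] : Prop :=
  (∀ a : A, (∀ b : A, a * b = 0) → a = 0) ∧ (∀ a : A, (∀ b : A, b * a = 0) → a = 0)

section Multiplier

variable (A : Type*) [NonUnitalRing A] [Module ℂ A] [SMulCommClass ℂ A A] [IsScalarTower ℂ A A]

/-- The pairs `(L, R)` of linear maps on `A` with `R b * a = b * L a`, as a unital subalgebra of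
`End A × (End A)ᵐᵒᵖ`; so left actions compose in the usual order and right actions in the
opposite order. -/
def multiplierSubalgebra : Subalgebra ℂ (Module.End ℂ A × (Module.End ℂ A)ᵐᵒᵖ) where
  carrier := {m | ∀ b a : A, m.2.unop b * a = b * m.1 a}
  mul_mem' := by
    intro m n hm hn b a
    change n.2.unop (m.2.unop b) * a = b * m.1 (n.1 a)
    rw [hn, hm]
  add_mem' := by
    intro m n hm hn b a
    change (m.2.unop b + n.2.unop b) * a = b * (m.1 a + n.1 a)
    rw [add_mul, mul_add, hm, hn]
  algebraMap_mem' := by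
    intro r b a
    change (r • b) * a = b * (r • a)
    rw [smul_mul_assoc, mul_smul_comm]

/-- The multiplier algebra `M(A)`: a multiplier `m` is given by left multiplication `a ↦ m a` and
right multiplication `b ↦ b m`, subject to `(b m) a = b (m a)`. -/
def Multiplier : Type _ := ↥(multiplierSubalgebra A)

namespace Multiplier

noncomputable instance : Ring (Multiplier A) := inferInstanceAs (Ring ↥(multiplierSubalgebra A))

noncomputable instance : Algebra ℂ (Multiplier A) :=
  inferInstanceAs (Algebra ℂ ↥(multiplierSubalgebra A))

variable {A}

/-- Left multiplication `a ↦ m a` by a multiplier. -/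
def L (m : Multiplier A) : A →ₗ[ℂ] A := m.1.1

/-- Right multiplication `b ↦ b m` by a multiplier. -/
def R (m : Multiplier A) : A →ₗ[ℂ] A := m.1.2.unop

theorem R_mul (m : Multiplier A) (b a : A) : m.R b * a = b * m.L a := m.2 b a

/-- The multiplier with given left and right multiplications. -/
def mk (l r : A →ₗ[ℂ] A) (h : ∀ b a, r b * a = b * l a) : Multiplier A :=
  ⟨(l, MulOpposite.op r), h⟩

@[simp] theorem mk_L (l r : A →ₗ[ℂ] A) (h) : (mk l r h).L = l := rfl
@[simp] theorem mk_R (l r : A →ₗ[ℂ] A) (h) : (mk l r h).R = r := rfl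

@[ext] theorem ext {m n : Multiplier A} (hL : m.L = n.L) (hR : m.R = n.R) : m = n :=
  Subtype.ext (Prod.ext hL (MulOpposite.unop_injective hR))

@[simp] theorem one_L : (1 : Multiplier A).L = LinearMap.id := rfl
@[simp] theorem one_R : (1 : Multiplier A).R = LinearMap.id := rfl
@[simp] theorem mul_L (m n : Multiplier A) : (m * n).L = m.L ∘ₗ n.L := rfl
@[simp] theorem mul_R (m n : Multiplier A) : (m * n).R = n.R ∘ₗ m.R := rfl
@[simp] theorem add_L (m n : Multiplier A) : (m + n).L = m.L + n.L := rfl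
@[simp] theorem add_R (m n : Multiplier A) : (m + n).R = m.R + n.R := rfl
@[simp] theorem smul_L (c : ℂ) (m : Multiplier A) : (c • m).L = c • m.L := rfl
@[simp] theorem smul_R (c : ℂ) (m : Multiplier A) : (c • m).R = c • m.R := rfl

variable (A) in
/-- The canonical map `A → M(A)`, which is injective when the product is non-degenerate. -/
def of : A →ₙₐ[ℂ] Multiplier A where
  toFun a := mk (LinearMap.mulLeft ℂ a) (LinearMap.mulRight ℂ a) fun b c => by
    simp [mul_assoc]
  map_smul' c a := by
    ext x
    · exact smul_mul_assoc c a x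
    · exact mul_smul_comm c x a
  map_zero' := by
    ext x
    · exact zero_mul x
    · exact mul_zero x
  map_add' a b := by
    ext x
    · exact add_mul a b x
    · exact mul_add x a b
  map_mul' a b := by
    ext x
    · exact mul_assoc a b x
    · exact (mul_assoc x a b).symm

@[simp] theorem of_L (a x : A) : (of A a).L x = a * x := rfl
@[simp] theorem of_R (a x : A) : (of A a).R x = x * a := rfl

/-- If the product is non-degenerate, the actions of a multiplier are module maps, and each of
them determines the multiplier. -/
theorem L_mul (hA : NondegenerateProduct A) (m : Multiplier A) (a b : A) :
    m.L (a * b) = m.L a * b := by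
  rw [← sub_eq_zero]
  refine hA.2 _ fun c => ?_
  rw [mul_sub, ← R_mul, ← mul_assoc, ← mul_assoc, R_mul, sub_self]

theorem ext_L (hA : NondegenerateProduct A) {m n : Multiplier A} (h : m.L = n.L) : m = n := by
  refine ext h (LinearMap.ext fun b => ?_)
  rw [← sub_eq_zero]
  refine hA.1 _ fun c => ?_
  rw [sub_mul, R_mul, R_mul, h, sub_self]

end Multiplier

end Multiplier

section Star

namespace Multiplier

variable {A : Type*} [NonUnitalRing A] [StarRing A] [Module ℂ A] [StarModule ℂ A]
  [SMulCommClass ℂ A A] [IsScalarTower ℂ A A]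

/-- The involution of `M(A)` for a `*`-algebra `A`: `m⋆ a = (a⋆ m)⋆` and `b m⋆ = (m b⋆)⋆`. -/
instance : Star (Multiplier A) where
  star m := mk
    { toFun := fun a => star (m.R (star a))
      map_add' := fun a b => by simp
      map_smul' := fun c a => by simp }
    { toFun := fun b => star (m.L (star b))
      map_add' := fun a b => by simp
      map_smul' := fun c a => by simp }
    fun b a => by
      apply star_injective
      simp [R_mul]

end Multiplier

/-- The involution `(a ⊗ b)⋆ = a⋆ ⊗ b⋆` is antimultiplicative (for non-unital algebras). -/
noncomputable instance nonUnitalTensorStarRing {A B : Type*}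
    [NonUnitalRing A] [StarRing A] [Module ℂ A] [StarModule ℂ A] [SMulCommClass ℂ A A]
    [IsScalarTower ℂ A A]
    [NonUnitalRing B] [StarRing B] [Module ℂ B] [StarModule ℂ B] [SMulCommClass ℂ B B]
    [IsScalarTower ℂ B B] : StarRing (A ⊗[ℂ] B) where
  star_mul x y :=
    x.induction_on (by simp) (fun _ _ ↦
      y.induction_on (by simp)
        (fun _ _ ↦ by simp)
        fun _ _ h₁ h₂ ↦ by simp [add_mul, mul_add, h₁, h₂])
      fun _ _ h₁ h₂ ↦ by simp [add_mul, mul_add, h₁, h₂]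
  star_add := by simp

end Star

section Tensor

variable (A B : Type*)
  [NonUnitalRing A] [Module ℂ A] [SMulCommClass ℂ A A] [IsScalarTower ℂ A A]
  [NonUnitalRing B] [Module ℂ B] [SMulCommClass ℂ B B] [IsScalarTower ℂ B B]

namespace Multiplier

variable {A B} in
/-- The multiplier `m ⊗ n` of `A ⊗ B`, acting by `(m ⊗ n)(a ⊗ b) = m a ⊗ n b` and
`(a ⊗ b)(m ⊗ n) = a m ⊗ b n`. -/
noncomputable def tmul (m : Multiplier A) (n : Multiplier B) : Multiplier (A ⊗[ℂ] B) :=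
  mk (TensorProduct.map m.L n.L) (TensorProduct.map m.R n.R) fun x y => by
    induction x with
    | zero => simp
    | add x x' hx hx' => simp only [map_add, add_mul, hx, hx']
    | tmul b b' =>
      induction y with
      | zero => simp
      | add y y' hy hy' => simp only [map_add, mul_add, hy, hy']
      | tmul a a' => simp [R_mul]

/-- The canonical homomorphism of unital algebras `M(A) ⊗ M(B) → M(A ⊗ B)` defined on the
algebraic tensor product, through which `M(A) ⊗ M(B)` is regarded as a subalgebra of
`M(A ⊗ B)`. -/
noncomputable def tensor : Multiplier A ⊗[ℂ] Multiplier B →ₐ[ℂ] Multiplier (A ⊗[ℂ] B) :=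
  Algebra.TensorProduct.algHomOfLinearMapTensorProduct
    (TensorProduct.lift (LinearMap.mk₂ ℂ tmul
      (fun m m' n => by ext1 <;> simp [tmul, TensorProduct.map_add_left])
      (fun c m n => by ext1 <;> simp [tmul, TensorProduct.map_smul_left])
      (fun m n n' => by ext1 <;> simp [tmul, TensorProduct.map_add_right])
      (fun c m n => by ext1 <;> simp [tmul, TensorProduct.map_smul_right])))
    (fun m m' n n' => by ext1 <;> simp [tmul, TensorProduct.map_comp])
    (by ext1 <;> simp [tmul])

@[simp] theorem tensor_tmul_L (m : Multiplier A) (n : Multiplier B) :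
    (tensor A B (m ⊗ₜ n)).L = TensorProduct.map m.L n.L := rfl

@[simp] theorem tensor_tmul_R (m : Multiplier A) (n : Multiplier B) :
    (tensor A B (m ⊗ₜ n)).R = TensorProduct.map m.R n.R := rfl

end Multiplier

end Tensor

section Tensor

/-- Jointly injective families of linear maps stay jointly injective after tensoring. -/
theorem eq_zero_of_rTensor {ι V W E : Type*} [AddCommGroup V] [Module ℂ V] [AddCommGroup W]
    [Module ℂ W] [AddCommGroup E] [Module ℂ E] (f : ι → V →ₗ[ℂ] W)
    (hf : ∀ v, (∀ i, f i v = 0) → v = 0) (x : V ⊗[ℂ] E) (hx : ∀ i, (f i).rTensor E x = 0) :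
    x = 0 := by
  classical
  let β := Module.Basis.ofVectorSpace ℂ E
  have key : ∀ i (y : V ⊗[ℂ] E) k, TensorProduct.equivFinsuppOfBasisRight (M := W) β
      ((f i).rTensor E y) k =
        f i (TensorProduct.equivFinsuppOfBasisRight (M := V) β y k) := by
    intro i y k
    induction y with
    | zero => simp
    | tmul v e => simp
    | add y y' h h' => simp [h, h']
  apply (TensorProduct.equivFinsuppOfBasisRight (M := V) β).injective
  ext k
  rw [map_zero, Finsupp.zero_apply]
  refine hf _ fun i => ?_
  rw [← key, hx, map_zero, Finsupp.zero_apply]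

theorem eq_zero_of_lTensor {ι V W E : Type*} [AddCommGroup V] [Module ℂ V] [AddCommGroup W]
    [Module ℂ W] [AddCommGroup E] [Module ℂ E] (f : ι → V →ₗ[ℂ] W)
    (hf : ∀ v, (∀ i, f i v = 0) → v = 0) (x : E ⊗[ℂ] V) (hx : ∀ i, (f i).lTensor E x = 0) :
    x = 0 := by
  apply (TensorProduct.comm ℂ E V).injective
  rw [map_zero]
  refine eq_zero_of_rTensor f hf _ fun i => ?_
  rw [LinearMap.rTensor_def, TensorProduct.map_comm, ← LinearMap.lTensor_def, hx, map_zero]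

variable {A B : Type*}
  [NonUnitalRing A] [Module ℂ A] [SMulCommClass ℂ A A] [IsScalarTower ℂ A A]
  [NonUnitalRing B] [Module ℂ B] [SMulCommClass ℂ B B] [IsScalarTower ℂ B B]

/-- The tensor product of algebras with non-degenerate product has a non-degenerate product. -/
theorem NondegenerateProduct.tensor (hA : NondegenerateProduct A) (hB : NondegenerateProduct B) :
    NondegenerateProduct (A ⊗[ℂ] B) := by
  constructor
  · intro x hx
    refine eq_zero_of_rTensor (fun a : A => LinearMap.mulRight ℂ a) (fun v hv => hA.1 v hv) x
      fun a => ?_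
    refine eq_zero_of_lTensor (fun b : B => LinearMap.mulRight ℂ b) (fun v hv => hB.1 v hv) _
      fun b => ?_
    rw [← hx (a ⊗ₜ b)]
    clear hx
    induction x with
    | zero => simp
    | tmul v e => simp
    | add y y' h h' => simp [h, h', add_mul]
  · intro x hx
    refine eq_zero_of_rTensor (fun a : A => LinearMap.mulLeft ℂ a) (fun v hv => hA.2 v hv) x
      fun a => ?_
    refine eq_zero_of_lTensor (fun b : B => LinearMap.mulLeft ℂ b) (fun v hv => hB.2 v hv) _
      fun b => ?_
    rw [← hx (a ⊗ₜ b)]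
    clear hx
    induction x with
    | zero => simp
    | tmul v e => simp
    | add y y' h h' => simp [h, h', mul_add]

end Tensor

/-! ### Multiplier Hopf `*`-algebras and discrete quantum groups -/

open Multiplier in
/-- The structure of a multiplier Hopf `*`-algebra on a `*`-algebra `A`. The linear bijections
`T₁`, `T₂` of `A ⊗ A` are determined by `δ`: they say that `a ⊗ b ↦ δ(a)(1 ⊗ b)` and
`a ⊗ b ↦ (a ⊗ 1)δ(b)` take values in `A ⊗ A ⊆ M(A ⊗ A)` and are bijections onto `A ⊗ A`. -/
structure MultiplierHopfStarAlgebra (A : Type*) [NonUnitalRing A] [StarRing A] [Module ℂ A]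
    [StarModule ℂ A] [SMulCommClass ℂ A A] [IsScalarTower ℂ A A] where
  nondegenerate : NondegenerateProduct A
  /-- The comultiplication. -/
  δ : A →⋆ₙₐ[ℂ] Multiplier (A ⊗[ℂ] A)
  T₁ : (A ⊗[ℂ] A) ≃ₗ[ℂ] (A ⊗[ℂ] A)
  T₂ : (A ⊗[ℂ] A) ≃ₗ[ℂ] (A ⊗[ℂ] A)
  of_T₁ : ∀ a b : A, of (A ⊗[ℂ] A) (T₁ (a ⊗ₜ b)) = δ a * tensor A A (1 ⊗ₜ of A b)
  of_T₂ : ∀ a b : A, of (A ⊗[ℂ] A) (T₂ (a ⊗ₜ b)) = tensor A A (of A a ⊗ₜ 1) * δ b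
  /-- Coassociativity: `T₂ ⊗ id` and `id ⊗ T₁` commute on `A ⊗ A ⊗ A`. -/
  coassoc : Commute
    ((TensorProduct.assoc ℂ A A A).conj (T₂.toLinearMap.rTensor A) :
      Module.End ℂ (A ⊗[ℂ] (A ⊗[ℂ] A)))
    (T₁.toLinearMap.lTensor A)

namespace MultiplierHopfStarAlgebra

open Multiplier

variable {A : Type*} [NonUnitalRing A] [StarRing A] [Module ℂ A]
  [StarModule ℂ A] [SMulCommClass ℂ A A] [IsScalarTower ℂ A A] (G : MultiplierHopfStarAlgebra A)

theorem T₁_mul (a b : A) (x : A ⊗[ℂ] A) :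
    G.T₁ (a ⊗ₜ b) * x = (G.δ a).L (TensorProduct.map LinearMap.id (LinearMap.mulLeft ℂ b) x) :=
  LinearMap.congr_fun (congrArg Multiplier.L (G.of_T₁ a b)) x

theorem mul_T₂ (a b : A) (x : A ⊗[ℂ] A) :
    x * G.T₂ (a ⊗ₜ b) = (G.δ b).R (TensorProduct.map (LinearMap.mulRight ℂ a) LinearMap.id x) :=
  LinearMap.congr_fun (congrArg Multiplier.R (G.of_T₂ a b)) x

/-- `((a ⊗ 1)δ(b)) (δ(c)(1 ⊗ d)) = (a ⊗ 1) δ(bc) (1 ⊗ d)`, in terms of actions. -/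
theorem T₂_mul_T₁ (a b c d : A) (x : A ⊗[ℂ] A) :
    G.T₂ (a ⊗ₜ b) * G.T₁ (c ⊗ₜ d) * x =
      TensorProduct.map (LinearMap.mulLeft ℂ a) LinearMap.id
        ((G.δ (b * c)).L (TensorProduct.map LinearMap.id (LinearMap.mulLeft ℂ d) x)) := by
  have h := LinearMap.congr_fun (congrArg Multiplier.L (G.of_T₂ a b)) (G.T₁ (c ⊗ₜ d) * x)
  have h' : G.T₂ (a ⊗ₜ b) * (G.T₁ (c ⊗ₜ d) * x) = TensorProduct.map (LinearMap.mulLeft ℂ a)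
      LinearMap.id ((G.δ b).L (G.T₁ (c ⊗ₜ d) * x)) := h
  rw [mul_assoc, h', T₁_mul, map_mul, mul_L]
  rfl

theorem nondegenerate_tensor (G : MultiplierHopfStarAlgebra A) :
    NondegenerateProduct (A ⊗[ℂ] A) :=
  G.nondegenerate.tensor G.nondegenerate

theorem δ_L_T₁ (a b c : A) : (G.δ a).L (G.T₁ (b ⊗ₜ c)) = G.T₁ ((a * b) ⊗ₜ c) := by
  rw [← sub_eq_zero]
  refine G.nondegenerate_tensor.1 _ fun x => ?_
  rw [sub_mul, ← L_mul G.nondegenerate_tensor, T₁_mul, T₁_mul, map_mul, mul_L, sub_eq_zero]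
  rfl

/-- The extension of `δ` to a homomorphism of unital algebras `M(A) → M(A ⊗ A)`. The multiplier
`δ(m)` acts by `δ(m)(δ(a)(1 ⊗ b)) = δ(m a)(1 ⊗ b)` and
`((a ⊗ 1)δ(b))δ(m) = (a ⊗ 1)δ(b m)`. -/
noncomputable def extend : Multiplier A →ₐ[ℂ] Multiplier (A ⊗[ℂ] A) :=
  AlgHom.ofLinearMap
    { toFun := fun m => Multiplier.mk
        (G.T₁.toLinearMap ∘ₗ m.L.rTensor A ∘ₗ G.T₁.symm.toLinearMap)
        (G.T₂.toLinearMap ∘ₗ m.R.lTensor A ∘ₗ G.T₂.symm.toLinearMap)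
        (fun x y => by
          obtain ⟨x, rfl⟩ := G.T₂.surjective x
          obtain ⟨y, rfl⟩ := G.T₁.surjective y
          simp only [LinearMap.comp_apply, LinearEquiv.coe_coe, LinearEquiv.symm_apply_apply]
          induction x with
          | zero => simp
          | add x x' hx hx' => simp only [map_add, add_mul, hx, hx']
          | tmul a b =>
            induction y with
            | zero => simp
            | add y y' hy hy' => simp only [map_add, mul_add, hy, hy']
            | tmul c d =>
              rw [← sub_eq_zero]
              refine G.nondegenerate_tensor.1 _ fun z => ?_
              simp only [LinearMap.lTensor_tmul, LinearMap.rTensor_tmul, sub_mul, T₂_mul_T₁,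
                Multiplier.R_mul, sub_self])
      map_add' := fun m n => by
        ext1 <;> simp [LinearMap.rTensor_add, LinearMap.lTensor_add, LinearMap.add_comp,
          LinearMap.comp_add]
      map_smul' := fun c m => by
        ext1 <;> simp [LinearMap.rTensor_smul, LinearMap.lTensor_smul, LinearMap.smul_comp,
          LinearMap.comp_smul] }
    (by ext x <;> simp)
    (fun m n => by
      apply Multiplier.ext <;> refine LinearMap.ext fun x => ?_ <;>
        simp [LinearMap.rTensor_comp, LinearMap.lTensor_comp])

/-- `extend` does extend `δ`. -/
theorem extend_of (a : A) : G.extend (of A a) = G.δ a := by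
  apply ext_L G.nondegenerate_tensor
  refine LinearMap.ext fun x => ?_
  obtain ⟨x, rfl⟩ := G.T₁.surjective x
  have h : (G.extend (of A a)).L (G.T₁ x) = G.T₁ ((of A a).L.rTensor A x) :=
    congrArg (fun y => G.T₁ ((of A a).L.rTensor A y)) (G.T₁.symm_apply_apply x)
  rw [h]
  clear h
  induction x with
  | zero => simp
  | add x x' hx hx' => simp only [map_add, hx, hx']
  | tmul b c => rw [LinearMap.rTensor_tmul, of_L, δ_L_T₁]

/-- The extension of `δ` to a homomorphism of unital algebras is unique. -/
theorem extend_unique (Δ : Multiplier A →ₐ[ℂ] Multiplier (A ⊗[ℂ] A))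
    (h : ∀ a, Δ (of A a) = G.δ a) : Δ = G.extend := by
  refine AlgHom.ext fun m => ext_L G.nondegenerate_tensor (LinearMap.ext fun x => ?_)
  have hm : ∀ a, m * of A a = of A (m.L a) := fun a =>
    ext_L G.nondegenerate (LinearMap.ext fun c => L_mul G.nondegenerate m a c)
  have hΔ : ∀ a, Δ m * G.δ a = G.extend m * G.δ a := fun a => by
    rw [← h a, ← map_mul, hm, h, ← extend_of, ← hm, map_mul, extend_of, h]
  obtain ⟨x, rfl⟩ := G.T₁.surjective x
  induction x with
  | zero => simp
  | add x x' hx hx' => simp only [map_add, hx, hx']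
  | tmul a b =>
    rw [← sub_eq_zero]
    refine G.nondegenerate_tensor.1 _ fun z => ?_
    rw [sub_mul, ← L_mul G.nondegenerate_tensor, ← L_mul G.nondegenerate_tensor, T₁_mul,
      sub_eq_zero]
    exact LinearMap.congr_fun (congrArg Multiplier.L (hΔ a)) _

/-- The algebra `AP = {x ∈ M(A) : δ(x) ∈ M(A) ⊗ M(A)}` of almost periodic elements. -/
noncomputable def almostPeriodic : Subalgebra ℂ (Multiplier A) :=
  (tensor A A).range.comap G.extend

end MultiplierHopfStarAlgebra

/-- As an algebra, `A` is (isomorphic to) a direct sum of full matrix algebras `M_{n i}(ℂ)`. -/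
def IsDirectSumOfMatrixAlgebras.{u} (A : Type u) [NonUnitalRing A] [Module ℂ A] : Prop :=
  ∃ (I : Type u) (n : I → ℕ) (e : A ≃ₗ[ℂ] Π₀ i, Matrix (Fin (n i)) (Fin (n i)) ℂ),
    (∀ i, 0 < n i) ∧ ∀ a b i, e (a * b) i = e a i * e b i

/-- A discrete quantum group: a multiplier Hopf `*`-algebra `(A, δ)` such that `A` is a direct
sum of full matrix algebras. -/
structure DiscreteQuantumGroup (A : Type*) [NonUnitalRing A] [StarRing A] [Module ℂ A]
    [StarModule ℂ A] [SMulCommClass ℂ A A] [IsScalarTower ℂ A A]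
    extends MultiplierHopfStarAlgebra A where
  isDirectSum : IsDirectSumOfMatrixAlgebras A

/-! No nonzero `x` in `A` can be almost periodic; the proof runs this for a block identity `x`. If
`δ(x) = t` with `t` in `M(A) ⊗ M(A)`, then `t` lies in `X ⊗ M(A)` for some finite-dimensional `X`,
so finitely many maps `m ↦ a m` already separate the points of `X`. For each such `a`, the element
`(a ⊗ 1)δ(x) = T₂(a ⊗ x)` lies in `A ⊗ A`, so right multiplication by `1 ⊗ p i` kills it for all but
finitely many block identities `p i`. As there are infinitely many blocks, one `p i` works for every
chosen `a`. Separation on `X` then gives `t(1 ⊗ p i) = 0`, that is `T₁(x ⊗ p i) = 0`, which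
contradicts the injectivity of `T₁`. The bridge between the two one-sided products is
`lTensor_mulRight_eq_rTensor_evalR`; the final contradiction rests on `tmul_eq_zero_of_evalL`. -/

/-! ### Linear algebra and block identities -/

/-- A jointly injective family of linear maps on a finite-dimensional space has a finite jointly
injective subfamily. -/
theorem exists_finset_jointly_injective {ι V W : Type*} [AddCommGroup V] [Module ℂ V]
    [FiniteDimensional ℂ V] [AddCommGroup W] [Module ℂ W] (f : ι → V →ₗ[ℂ] W)
    (hf : ∀ v, (∀ i, f i v = 0) → v = 0) :
    ∃ F : Finset ι, ∀ v, (∀ i ∈ F, f i v = 0) → v = 0 := by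
  classical
  -- Take a minimal finite intersection of kernels: inserting a further index cannot shrink it, so
  -- it lies in every kernel.
  obtain ⟨_, ⟨F, rfl⟩, hF⟩ := IsArtinian.set_has_minimal
    (Set.range fun F : Finset ι => ⨅ i ∈ F, LinearMap.ker (f i)) (Set.range_nonempty _)
  refine ⟨F, fun v hv => hf v fun i => ?_⟩
  by_contra hi
  refine hF _ ⟨insert i F, rfl⟩ (lt_of_le_of_ne ?_ fun h => hi ?_)
  · exact biInf_mono fun j hj => Finset.mem_insert_of_mem hj
  · have hmem : v ∈ ⨅ j ∈ F, LinearMap.ker (f j) := by simpa using hv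
    rw [← show _ = ⨅ j ∈ F, LinearMap.ker (f j) from h] at hmem
    simp only [Submodule.mem_iInf, LinearMap.mem_ker] at hmem
    exact hmem i (Finset.mem_insert_self i F)

/-- An infinite direct sum of matrix algebras contains nonzero elements, indexed by an infinite
set, such that every element of the algebra is annihilated by all but finitely many of them. -/
theorem IsDirectSumOfMatrixAlgebras.exists_eventually_mul_eq_zero.{u} {A : Type u} [NonUnitalRing A]
    [Module ℂ A] (h : IsDirectSumOfMatrixAlgebras A) (hA : ¬ FiniteDimensional ℂ A) :
    ∃ (I : Type u) (p : I → A), Infinite I ∧ (∀ i, p i ≠ 0) ∧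
      ∀ a, ∀ᶠ i in Filter.cofinite, a * p i = 0 := by
  classical
  obtain ⟨I, n, e, hn, hmul⟩ := h
  -- `p i` is the identity of the `i`-th block, so `a * p i` vanishes for `i` outside the support of
  -- `e a`.
  refine ⟨I, fun i => e.symm (DFinsupp.single i 1), ?_, fun i hi => ?_, fun a => ?_⟩
  · by_contra hI
    have : Finite I := not_infinite_iff_finite.mp hI
    have := Fintype.ofFinite I
    have : FiniteDimensional ℂ (Π₀ i, Matrix (Fin (n i)) (Fin (n i)) ℂ) :=
      Module.Finite.equiv (DFinsupp.linearEquivFunOnFintype (R := ℂ)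
        (M := fun i => Matrix (Fin (n i)) (Fin (n i)) ℂ)).symm
    exact hA (Module.Finite.equiv e.symm)
  · have : NeZero (n i) := ⟨(hn i).ne'⟩
    rw [LinearEquiv.map_eq_zero_iff, DFinsupp.single_eq_zero] at hi
    exact one_ne_zero hi
  · refine (e a).support.finite_toSet.subset fun i hi => ?_
    by_contra hia
    refine hi (e.injective (DFinsupp.ext fun j => ?_))
    rw [hmul, LinearEquiv.apply_symm_apply, map_zero, DFinsupp.zero_apply]
    by_cases hij : i = j
    · subst hij
      have : e a i = 0 := by simpa using hia
      rw [this, zero_mul]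
    · rw [DFinsupp.single_eq_of_ne (Ne.symm hij), mul_zero]

/-- The map `a ↦ a p i` on the second leg eventually annihilates each tensor, if it does so on each
element. -/
theorem eventually_lTensor_mulRight_eq_zero {I A : Type*} [NonUnitalRing A] [Module ℂ A]
    [SMulCommClass ℂ A A] [IsScalarTower ℂ A A] {p : I → A} {l : Filter I}
    (hp : ∀ a, ∀ᶠ i in l, a * p i = 0) (w : A ⊗[ℂ] A) :
    ∀ᶠ i in l, (LinearMap.mulRight ℂ (p i)).lTensor A w = 0 := by
  induction w with
  | zero => simp
  | tmul a b =>
    filter_upwards [hp b] with i hi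
    simp [hi]
  | add w w' hw hw' =>
    filter_upwards [hw, hw'] with i hi hi'
    rw [map_add, hi, hi', add_zero]

/-! ### Slicing elements of `M(A) ⊗ M(A)` -/

namespace Multiplier

variable {A : Type*} [NonUnitalRing A] [Module ℂ A] [SMulCommClass ℂ A A] [IsScalarTower ℂ A A]

/-- The linear map `m ↦ m a`. -/
def evalL (a : A) : Multiplier A →ₗ[ℂ] A where
  toFun m := m.L a
  map_add' _ _ := rfl
  map_smul' _ _ := rfl

/-- The linear map `m ↦ a m`. -/
def evalR (a : A) : Multiplier A →ₗ[ℂ] A where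
  toFun m := m.R a
  map_add' _ _ := rfl
  map_smul' _ _ := rfl

@[simp] theorem evalL_apply (a : A) (m : Multiplier A) : evalL a m = m.L a := rfl

@[simp] theorem evalR_apply (a : A) (m : Multiplier A) : evalR a m = m.R a := rfl

theorem eq_zero_of_evalR (hA : NondegenerateProduct A) {m : Multiplier A}
    (h : ∀ a, evalR a m = 0) : m = 0 := by
  refine ext_L hA (LinearMap.ext fun b => hA.2 _ fun c => ?_)
  rw [← R_mul, ← evalR_apply, h, zero_mul]

/-- The action of `t ∈ M(A) ⊗ M(A)` on `a ⊗ (b c)`, through `t (1 ⊗ b) ∈ M(A) ⊗ A`. -/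
theorem tensor_L_tmul_mul (hA : NondegenerateProduct A) (t : Multiplier A ⊗[ℂ] Multiplier A)
    (a b c : A) :
    (tensor A A t).L (a ⊗ₜ (b * c)) =
      TensorProduct.map (evalL a) (LinearMap.mulRight ℂ c) ((evalL b).lTensor _ t) := by
  induction t with
  | zero => simp only [map_zero]; rfl
  | tmul m n => simp [L_mul hA]
  | add t t' h h' => simp only [map_add, add_L, LinearMap.add_apply, h, h']

/-- If `w = (a ⊗ 1) t` lies in `A ⊗ A`, then `w (1 ⊗ b) = (a ⊗ 1) (t (1 ⊗ b))`. -/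
theorem lTensor_mulRight_eq_rTensor_evalR (hA : NondegenerateProduct A)
    (t : Multiplier A ⊗[ℂ] Multiplier A) (a b : A) (w : A ⊗[ℂ] A)
    (hw : of (A ⊗[ℂ] A) w = tensor A A (of A a ⊗ₜ 1) * tensor A A t) :
    (LinearMap.mulRight ℂ b).lTensor A w = (evalR a).rTensor A ((evalL b).lTensor _ t) := by
  rw [← sub_eq_zero]
  -- By non-degeneracy it suffices to compare products with `c ⊗ d`; both become `w (c ⊗ b d)`.
  refine (hA.tensor hA).1 _ fun x => ?_
  rw [sub_mul, sub_eq_zero]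
  induction x with
  | zero => simp
  | add x x' h h' => simp only [mul_add, h, h']
  | tmul c d =>
    have h₁ : ∀ v : A ⊗[ℂ] A, (LinearMap.mulRight ℂ b).lTensor A v * c ⊗ₜ d =
        v * c ⊗ₜ (b * d) := fun v => by
      induction v with
      | zero => simp
      | tmul p q => simp [mul_assoc]
      | add v v' h h' => simp only [map_add, add_mul, h, h']
    have h₂ : ∀ s : Multiplier A ⊗[ℂ] A, (evalR a).rTensor A s * c ⊗ₜ d =
        TensorProduct.map (LinearMap.mulLeft ℂ a) LinearMap.id
          (TensorProduct.map (evalL c) (LinearMap.mulRight ℂ d) s) := fun s => by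
      induction s with
      | zero => simp
      | tmul p q => simp [R_mul]
      | add v v' h h' => simp only [map_add, add_mul, h, h']
    rw [h₁, h₂, ← tensor_L_tmul_mul hA]
    exact LinearMap.congr_fun (congrArg Multiplier.L hw) (c ⊗ₜ (b * d))

end Multiplier

/-! ### Contradiction from the injectivity of `T₁` -/

open Multiplier in
/-- If `δ(x) = t ∈ M(A) ⊗ M(A)`, then `t (1 ⊗ b) = 0` in `M(A) ⊗ A` only if `x = 0` or `b = 0`. -/
theorem MultiplierHopfStarAlgebra.tmul_eq_zero_of_evalL {A : Type*} [NonUnitalRing A] [StarRing A]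
    [Module ℂ A] [StarModule ℂ A] [SMulCommClass ℂ A A] [IsScalarTower ℂ A A]
    (G : MultiplierHopfStarAlgebra A) {x b : A} {t : Multiplier A ⊗[ℂ] Multiplier A}
    (ht : tensor A A t = G.δ x) (hb : (evalL b).lTensor _ t = 0) : x ⊗ₜ[ℂ] b = 0 := by
  -- `T₁(x ⊗ b)` acts on `c ⊗ d` as `t` acts on `c ⊗ b d`, which depends only on `t(1 ⊗ b)`.
  refine G.T₁.map_eq_zero_iff.mp (G.nondegenerate_tensor.1 _ fun y => ?_)
  induction y with
  | zero => simp
  | add y y' h h' => simp only [mul_add, h, h', add_zero]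
  | tmul c d =>
    rw [G.T₁_mul, ← ht, TensorProduct.map_tmul]
    exact (tensor_L_tmul_mul G.nondegenerate t c b d).trans (by rw [hb, map_zero])

open Multiplier in
theorem mainTheorem4 {A : Type*} [NonUnitalRing A] [StarRing A] [Module ℂ A] [StarModule ℂ A]
    [SMulCommClass ℂ A A] [IsScalarTower ℂ A A] (G : DiscreteQuantumGroup A)
    (hA : ¬ FiniteDimensional ℂ A) :
    ¬ Set.range (Multiplier.of A) ⊆ (G.almostPeriodic : Set (Multiplier A)) := by
  intro hAP
  obtain ⟨I, p, hI, hp0, hp⟩ := G.isDirectSum.exists_eventually_mul_eq_zero hA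
  obtain ⟨i₀⟩ := hI.nonempty
  obtain ⟨t, ht⟩ := hAP ⟨p i₀, rfl⟩
  replace ht : tensor A A t = G.δ (p i₀) := ht.trans (G.extend_of (p i₀))
  obtain ⟨X, hX, hXt⟩ := TensorProduct.exists_finite_submodule_left_of_setFinite {t}
    (Set.finite_singleton t)
  -- `s` is `t` viewed in `X ⊗ M(A)`, where finitely many maps suffice to detect zero.
  obtain ⟨s, hs⟩ := hXt rfl
  obtain ⟨F, hF⟩ := exists_finset_jointly_injective
    (fun a : A => (evalR a).comp X.subtype)
    (fun v hv => Subtype.ext (eq_zero_of_evalR G.nondegenerate hv))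
  -- Finitely many cofinite conditions hold together, and `I` being infinite supplies an index
  -- satisfying them all.
  obtain ⟨i, hi⟩ := ((Filter.eventually_all_finset F).mpr fun a _ =>
    eventually_lTensor_mulRight_eq_zero hp (G.T₂ (a ⊗ₜ p i₀))).exists
  have hz : (evalL (p i)).lTensor X s = 0 := by
    refine eq_zero_of_rTensor (fun a : F => (evalR (a : A)).comp X.subtype)
      (fun v hv => hF v fun a ha => hv ⟨a, ha⟩) _ fun a => ?_
    rw [← hi a a.2, lTensor_mulRight_eq_rTensor_evalR G.nondegenerate t a (p i) _
      (by rw [G.of_T₂, ht]), ← hs]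
    simp only [LinearMap.rTensor, LinearMap.lTensor, ← LinearMap.comp_apply,
      ← TensorProduct.map_comp]
    rfl
  -- The inclusion of `X` in `M(A)` carries the vanishing of `hz` over to `t(1 ⊗ p i)`.
  have hzero := G.tmul_eq_zero_of_evalL ht (b := p i) (by
    rw [← hs, ← LinearMap.comp_apply, LinearMap.lTensor_comp_rTensor,
      ← LinearMap.rTensor_comp_lTensor, LinearMap.comp_apply, hz, map_zero])
  -- Applying a functional `f` to the first leg gives `f (p i₀) • p i = 0`, so every `f` vanishes at
  -- `p i₀`.
  refine hp0 i₀ ((Module.forall_dual_apply_eq_zero_iff ℂ (p i₀)).mp fun f => ?_)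
  have hf := congrArg (TensorProduct.lid ℂ A ∘ f.rTensor A) hzero
  simp only [Function.comp_apply, LinearMap.rTensor_tmul, TensorProduct.lid_tmul, map_zero] at hf
  exact (smul_eq_zero.mp hf).resolve_right (hp0 i)
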